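/- Let $M$ be a smooth (Hausdorff) manifold of dimension $2n+1$ and let $\varepsilon_0,\varepsilon_1,\delta\in\{1,-1\}$. Let $(\varphi,\xi,\eta,g)$ be an almost (para)contact metric structure on $M$: $\varphi$ is a smooth $(1,1)$-tensor field, $\xi$ a smooth vector field, $\eta$ a smooth $1$-form and $g$ a smooth Riemannian or pseudo-Riemannian metric such that, for all vector fields $X,Y$, $$\varphi^2X=\varepsilon_1(X-\eta(X)\xi),\qquad \eta(\xi)=1,\qquad g(\varphi X,\varphi Y)=-\varepsilon_1\bigl(g(X,Y)-\varepsilon_0\,\eta(X)\eta(Y)\bigr).$$ Let $\nabla$ be the Levi-Civita connection of $g$, $R(X,Y)=[\nabla_X,\nabla_Y]-\nabla_{[X,Y]}$ its curvature operator, $(\nabla_X\varphi)Y=\nabla_X(\varphi Y)-\varphi(\nabla_XY)$, $(\nabla_X\eta)(Y)=X(\eta(Y))-\eta(\nabla_XY)$, $[R(X,Y),\varphi]=R(X,Y)\circ\varphi-\varphi\circ R(X,Y)$, and let $$N(X,Y)=\varphi^2[X,Y]+[\varphi X,\varphi Y]-\varphi[\varphi X,Y]-\varphi[X,\varphi Y]$$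 be the Nijenhuis tensor of $\varphi$. Assume that for all smooth vector fields $X,Y$ on $M$ $$(\nabla_{\varphi X}\varphi)Y-\delta\varphi(\nabla_X\varphi)Y-\delta\varepsilon_1(\nabla_X\eta)(Y)\,\xi=(\delta-1)\bigl(\varepsilon_1g(\varphi X,Y)\,\xi-\varepsilon_0\varepsilon_1\eta(Y)\,\varphi X\bigr).$$ Then for all smooth vector fields $X,Y,Z$ on $M$ $$\begin{aligned} &\bigl(\delta[R(Z,\varphi X),\varphi]+\delta[R(\varphi Z,X),\varphi]+\varepsilon_1[R(\varphi Z,\varphi X),\varphi]\varphi+[R(Z,X),\varphi]\varphi\bigr)Y\\ &\quad+\eta(Y)\bigl(R(\varphi Z,\varphi X)\xi+\varepsilon_1R(Z,X)\xi\bigr)\\ &=\delta\varepsilon_1\bigl\{(\nabla_{\varphi N(Z,X)}\varphi)Y+\varepsilon_1g(\varphi N(Z,X),Y)\,\xi-\varepsilon_0\varepsilon_1\eta(Y)\,\varphi N(Z,X)\bigr\}\\ &\quad-\varepsilon_0\varepsilon_1(\delta-1)\bigl\{2g(\varphi Z,Y)\varphi X-2g(\varphi X,Y)\varphi Z-g(\varphi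 Z,\varphi Y)X\\ &\qquad\qquad+g(\varphi X,\varphi Y)Z+g(Z,Y)\varphi^2X-g(X,Y)\varphi^2Z\bigr\}. \end{aligned}$$ -/

import Mathlib

open scoped Manifold ContDiff Bundle

noncomputable section

namespace ParaContact

section Fields

variable (E : Type*) [NormedAddCommGroup E] [NormedSpace ℝ E]
  (M : Type*) [TopologicalSpace M] [ChartedSpace E M]

/-- A (not necessarily smooth) vector field on a manifold `M` modelled on `E`. -/
abbrev VField : Type _ := Π x : M, TangentSpace 𝓘(ℝ, E) x

/-- A (not necessarily smooth) `1`-form on `M`. -/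
abbrev OneForm : Type _ := Π x : M, TangentSpace 𝓘(ℝ, E) x →L[ℝ] ℝ

/-- A (not necessarily smooth) tensor field of type `(1,1)` on `M`. -/
abbrev EndField : Type _ := Π x : M, TangentSpace 𝓘(ℝ, E) x →L[ℝ] TangentSpace 𝓘(ℝ, E) x

/-- A (not necessarily smooth) tensor field of type `(0,2)` on `M`. -/
abbrev BilinField : Type _ :=
  Π x : M, TangentSpace 𝓘(ℝ, E) x →L[ℝ] TangentSpace 𝓘(ℝ, E) x →L[ℝ] ℝ

end Fields

section Smooth

variable {E : Type*} [NormedAddCommGroup E] [NormedSpace ℝ E]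
  {M : Type*} [TopologicalSpace M] [ChartedSpace E M] [IsManifold 𝓘(ℝ, E) ∞ M]

/-- `X` is a smooth vector field, i.e. `X ∈ 𝔛(M)`. -/
def SmoothVField (X : VField E M) : Prop :=
  ContMDiff 𝓘(ℝ, E) (𝓘(ℝ, E).prod 𝓘(ℝ, E)) ∞
    (fun x ↦ (Bundle.TotalSpace.mk' E x (X x) : TangentBundle 𝓘(ℝ, E) M))

/-- `α` is a smooth `1`-form. -/
def SmoothOneForm (α : OneForm E M) : Prop :=
  ContMDiff 𝓘(ℝ, E) (𝓘(ℝ, E).prod 𝓘(ℝ, E →L[ℝ] ℝ)) ∞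
    (fun x ↦ Bundle.TotalSpace.mk' (E →L[ℝ] ℝ)
      (E := fun y : M ↦ TangentSpace 𝓘(ℝ, E) y →L[ℝ] Bundle.Trivial M ℝ y) x (α x))

/-- `A` is a smooth tensor field of type `(1,1)`. -/
def SmoothEndField (A : EndField E M) : Prop :=
  ContMDiff 𝓘(ℝ, E) (𝓘(ℝ, E).prod 𝓘(ℝ, E →L[ℝ] E)) ∞
    (fun x ↦ Bundle.TotalSpace.mk' (E →L[ℝ] E)
      (E := fun y : M ↦ TangentSpace 𝓘(ℝ, E) y →L[ℝ] TangentSpace 𝓘(ℝ, E) y) x (A x))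

/-- `B` is a smooth tensor field of type `(0,2)`. -/
def SmoothBilinField (B : BilinField E M) : Prop :=
  ContMDiff 𝓘(ℝ, E) (𝓘(ℝ, E).prod 𝓘(ℝ, E →L[ℝ] E →L[ℝ] ℝ)) ∞
    (fun x ↦ Bundle.TotalSpace.mk' (E →L[ℝ] E →L[ℝ] ℝ)
      (E := fun y : M ↦
        TangentSpace 𝓘(ℝ, E) y →L[ℝ] TangentSpace 𝓘(ℝ, E) y →L[ℝ] Bundle.Trivial M ℝ y) x (B x))

end Smooth

/-- A smooth Riemannian or pseudo-Riemannian metric on `M` (of arbitrary signature). -/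
structure PseudoMetric (E : Type*) [NormedAddCommGroup E] [NormedSpace ℝ E]
    (M : Type*) [TopologicalSpace M] [ChartedSpace E M] [IsManifold 𝓘(ℝ, E) ∞ M] where
  val : BilinField E M
  symm : ∀ (x : M) (v w : TangentSpace 𝓘(ℝ, E) x), val x v w = val x w v
  nondegenerate : ∀ (x : M) (v : TangentSpace 𝓘(ℝ, E) x), (∀ w, val x v w = 0) → v = 0
  smooth : SmoothBilinField val

section LeviCivita

variable {E : Type*} [NormedAddCommGroup E] [NormedSpace ℝ E]
  {M : Type*} [TopologicalSpace M] [ChartedSpace E M] [IsManifold 𝓘(ℝ, E) ∞ M]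

open VectorField

/-- The function `x ↦ g(X, Y)(x)`. -/
def PseudoMetric.fn (g : PseudoMetric E M) (X Y : VField E M) : M → ℝ := fun x ↦ g.val x (X x) (Y x)

lemma PseudoMetric.fn_mdiffAt (g : PseudoMetric E M) {X Y : VField E M} {x : M}
    (hX : MDiffAt (T% X) x) (hY : MDiffAt (T% Y) x) : MDiffAt (g.fn X Y) x := by
  have hg := (g.smooth.contMDiffAt (x := x)).mdifferentiableAt (by simp)
  have : MDifferentiableAt 𝓘(ℝ, E) (𝓘(ℝ, E).prod 𝓘(ℝ, ℝ))
      (fun m ↦ Bundle.TotalSpace.mk' ℝ (E := Bundle.Trivial M ℝ) m (g.val m (X m) (Y m))) x :=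
    MDifferentiableAt.clm_bundle_apply₂ (F₁ := E) (F₂ := E) hg hX hY
  simp only [mdifferentiableAt_totalSpace] at this
  exact this.2

/-- Half of the right-hand side of the Koszul formula, so that
`g(∇_X Y, Z) = koszul g Y X Z`. -/
def koszul (g : PseudoMetric E M) (Y X Z : VField E M) (x : M) : ℝ :=
  (1 / 2 : ℝ) *
    (mvfderiv 𝓘(ℝ, E) (g.fn Y Z) x (X x) + mvfderiv 𝓘(ℝ, E) (g.fn X Z) x (Y x)
      - mvfderiv 𝓘(ℝ, E) (g.fn X Y) x (Z x)
      + g.val x (mlieBracket 𝓘(ℝ, E) X Y x) (Z x)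
      - g.val x (mlieBracket 𝓘(ℝ, E) X Z x) (Y x)
      - g.val x (mlieBracket 𝓘(ℝ, E) Y Z x) (X x))

lemma fn_smul_left (g : PseudoMetric E M) (f : M → ℝ) (X Y : VField E M) :
    g.fn (f • X) Y = f * g.fn X Y := by
  ext x; simp [PseudoMetric.fn]

lemma fn_smul_right (g : PseudoMetric E M) (f : M → ℝ) (X Y : VField E M) :
    g.fn X (f • Y) = f * g.fn X Y := by
  ext x; simp [PseudoMetric.fn]

lemma fn_add_left (g : PseudoMetric E M) (X X' Y : VField E M) :
    g.fn (X + X') Y = g.fn X Y + g.fn X' Y := by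
  ext x; simp [PseudoMetric.fn]

lemma fn_add_right (g : PseudoMetric E M) (X Y Y' : VField E M) :
    g.fn X (Y + Y') = g.fn X Y + g.fn X Y' := by
  ext x; simp [PseudoMetric.fn]

variable [CompleteSpace E]

lemma koszul_tensorial_dir (g : PseudoMetric E M) {Y Z : VField E M} {x : M}
    (hY : MDiffAt (T% Y) x) (hZ : MDiffAt (T% Z) x) :
    TensorialAt 𝓘(ℝ, E) E (fun X ↦ koszul g Y X Z x) x where
  smul {f X} hf hX := by
    simp only [koszul, fn_smul_left, mlieBracket_smul_left hf hX,
      mvfderiv_mul hf (g.fn_mdiffAt hX hZ), mvfderiv_mul hf (g.fn_mdiffAt hX hY)]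
    simp [PseudoMetric.fn]
    ring
  add {X X'} hX hX' := by
    simp only [koszul, fn_add_left, mlieBracket_add_left hX hX',
      mvfderiv_add (g.fn_mdiffAt hX hZ) (g.fn_mdiffAt hX' hZ),
      mvfderiv_add (g.fn_mdiffAt hX hY) (g.fn_mdiffAt hX' hY)]
    simp
    ring

lemma koszul_tensorial_test (g : PseudoMetric E M) {Y X : VField E M} {x : M}
    (hY : MDiffAt (T% Y) x) (hX : MDiffAt (T% X) x) :
    TensorialAt 𝓘(ℝ, E) E (fun Z ↦ koszul g Y X Z x) x where
  smul {f Z} hf hZ := by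
    simp only [koszul, fn_smul_right, mlieBracket_smul_right hf hZ,
      mvfderiv_mul hf (g.fn_mdiffAt hX hZ), mvfderiv_mul hf (g.fn_mdiffAt hY hZ)]
    simp [PseudoMetric.fn, g.symm x (Z x)]
    ring
  add {Z Z'} hZ hZ' := by
    simp only [koszul, fn_add_right, mlieBracket_add_right hZ hZ',
      mvfderiv_add (g.fn_mdiffAt hX hZ) (g.fn_mdiffAt hX hZ'),
      mvfderiv_add (g.fn_mdiffAt hY hZ) (g.fn_mdiffAt hY hZ')]
    simp
    ring

variable [FiniteDimensional ℝ E]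

instance (x : M) : FiniteDimensional ℝ (TangentSpace 𝓘(ℝ, E) x) :=
  inferInstanceAs (FiniteDimensional ℝ E)

instance (x : M) : T2Space (TangentSpace 𝓘(ℝ, E) x) :=
  inferInstanceAs (T2Space E)

/-- The tensor `(X, Z) ↦ g(∇_X Y, Z)` at the point `x`, given by the Koszul formula. -/
def koszulTensor (g : PseudoMetric E M) (Y : VField E M) (x : M) (hY : MDiffAt (T% Y) x) :
    TangentSpace 𝓘(ℝ, E) x →L[ℝ] TangentSpace 𝓘(ℝ, E) x →L[ℝ] ℝ :=
  TensorialAt.mkHom₂ (I := 𝓘(ℝ, E)) (F := E) (F' := E) (fun X Z ↦ koszul g Y X Z x) x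
    (fun _ hZ ↦ koszul_tensorial_dir g hY hZ) (fun _ hX ↦ koszul_tensorial_test g hY hX)

lemma koszulTensor_apply (g : PseudoMetric E M) {Y X Z : VField E M} {x : M}
    (hY : MDiffAt (T% Y) x) (hX : MDiffAt (T% X) x) (hZ : MDiffAt (T% Z) x) :
    koszulTensor g Y x hY (X x) (Z x) = koszul g Y X Z x :=
  TensorialAt.mkHom₂_apply (I := 𝓘(ℝ, E)) (F := E) (F' := E)
    (Φ := fun X Z ↦ koszul g Y X Z x) _ _ hX hZ

/-- The isomorphism `v ↦ g(v, ·)` of the metric at the point `x`. -/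
def PseudoMetric.flat (g : PseudoMetric E M) (x : M) :
    TangentSpace 𝓘(ℝ, E) x ≃ₗ[ℝ] Module.Dual ℝ (TangentSpace 𝓘(ℝ, E) x) :=
  LinearMap.linearEquivOfInjective
    (ContinuousLinearMap.coeLM ℝ ∘ₗ (g.val x).toLinearMap)
    ((injective_iff_map_eq_zero _).2 fun v hv ↦
      g.nondegenerate x v fun w ↦ congrArg (fun f ↦ f w) hv)
    Subspace.dual_finrank_eq.symm

open Classical in
/-- The value of the Levi-Civita connection: `leviCivitaFun g Y x v` is `(∇_v Y)(x)`, the vector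
with `g(∇_v Y, w)` given by the Koszul formula (and `0` if `Y` is not differentiable at `x`). -/
def leviCivitaFun (g : PseudoMetric E M) (Y : VField E M) (x : M) :
    TangentSpace 𝓘(ℝ, E) x →L[ℝ] TangentSpace 𝓘(ℝ, E) x :=
  if hY : MDiffAt (T% Y) x then
    LinearMap.toContinuousLinearMap ((g.flat x).symm.toLinearMap ∘ₗ
      ContinuousLinearMap.coeLM ℝ ∘ₗ (koszulTensor g Y x hY).toLinearMap)
  else 0

lemma leviCivitaFun_spec (g : PseudoMetric E M) {Y X Z : VField E M} {x : M}
    (hY : MDiffAt (T% Y) x) (hX : MDiffAt (T% X) x) (hZ : MDiffAt (T% Z) x) :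
    g.val x (leviCivitaFun g Y x (X x)) (Z x) = koszul g Y X Z x := by
  have h : g.flat x (leviCivitaFun g Y x (X x)) = (koszulTensor g Y x hY (X x)).toLinearMap := by
    simp [leviCivitaFun, hY]
  exact (congrArg (fun f ↦ f (Z x)) h).trans (koszulTensor_apply g hY hX hZ)

lemma PseudoMetric.ext_vec (g : PseudoMetric E M) {x : M} {v w : TangentSpace 𝓘(ℝ, E) x}
    (h : ∀ Z : VField E M, MDiffAt (T% Z) x → g.val x v (Z x) = g.val x w (Z x)) : v = w := by
  refine sub_eq_zero.1 (g.nondegenerate x _ fun u ↦ ?_)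
  have := h (FiberBundle.extend E u) (FiberBundle.mdifferentiableAt_extend ..)
  simp only [FiberBundle.extend_apply_self] at this
  simp [this]

/-- The Levi-Civita connection of a Riemannian or pseudo-Riemannian metric: `leviCivita g Y x (X x)`
is `(∇_X Y)(x)`. -/
def leviCivita (g : PseudoMetric E M) :
    CovariantDerivative 𝓘(ℝ, E) E (TangentSpace 𝓘(ℝ, E) : M → Type _) where
  toFun := leviCivitaFun g
  isCovariantDerivativeOnUniv :=
    { add := by
        intro Y Y' x hY hY' _
        have hS : MDiffAt (T% (Y + Y')) x := mdifferentiableAt_add_section hY hY'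
        apply VectorBundle.injective_eval_mdifferentiableAt_sec 𝓘(ℝ, E) E (TangentSpace 𝓘(ℝ, E))
        ext X hX
        refine g.ext_vec fun Z hZ ↦ ?_
        simp only [add_apply, map_add]
        rw [leviCivitaFun_spec g hS hX hZ, leviCivitaFun_spec g hY hX hZ,
          leviCivitaFun_spec g hY' hX hZ]
        simp only [koszul, fn_add_left, fn_add_right, mlieBracket_add_left hY hY',
          mlieBracket_add_right hY hY',
          mvfderiv_add (g.fn_mdiffAt hX hY) (g.fn_mdiffAt hX hY'),
          mvfderiv_add (g.fn_mdiffAt hY hZ) (g.fn_mdiffAt hY' hZ)]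
        simp
        ring
      leibniz := by
        intro Y f x hY hf _
        have hS : MDiffAt (T% (f • Y)) x := hf.smul_section hY
        apply VectorBundle.injective_eval_mdifferentiableAt_sec 𝓘(ℝ, E) E (TangentSpace 𝓘(ℝ, E))
        ext X hX
        refine g.ext_vec fun Z hZ ↦ ?_
        simp only [add_apply, map_add, smul_apply, map_smul]
        rw [leviCivitaFun_spec g hS hX hZ, leviCivitaFun_spec g hY hX hZ]
        simp only [koszul, fn_smul_left, fn_smul_right, mlieBracket_smul_left hf hY,
          mlieBracket_smul_right hf hY,
          mvfderiv_mul hf (g.fn_mdiffAt hX hY), mvfderiv_mul hf (g.fn_mdiffAt hY hZ)]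
        simp [PseudoMetric.fn, g.symm x (Y x) (X x)]
        ring }

/-- The Levi-Civita connection is torsion free. -/
lemma leviCivita_torsionFree (g : PseudoMetric E M) {X Y : VField E M} {x : M}
    (hX : MDiffAt (T% X) x) (hY : MDiffAt (T% Y) x) :
    leviCivita g Y x (X x) - leviCivita g X x (Y x) = mlieBracket 𝓘(ℝ, E) X Y x := by
  refine g.ext_vec fun Z hZ ↦ ?_
  simp only [map_sub, sub_apply]
  have h1 : g.val x (leviCivita g Y x (X x)) (Z x) = _ := leviCivitaFun_spec g hY hX hZ
  have h2 : g.val x (leviCivita g X x (Y x)) (Z x) = _ := leviCivitaFun_spec g hX hY hZ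
  have h3 : g.fn X Y = g.fn Y X := funext fun y ↦ g.symm y _ _
  have h4 : mlieBracket 𝓘(ℝ, E) Y X x = - mlieBracket 𝓘(ℝ, E) X Y x := mlieBracket_swap_apply
  rw [h1, h2]
  simp only [koszul, h3, h4]
  simp
  ring

/-- The Levi-Civita connection is metric. -/
lemma leviCivita_metric (g : PseudoMetric E M) {X Y Z : VField E M} {x : M}
    (hX : MDiffAt (T% X) x) (hY : MDiffAt (T% Y) x) (hZ : MDiffAt (T% Z) x) :
    mvfderiv 𝓘(ℝ, E) (g.fn Y Z) x (X x) =
      g.val x (leviCivita g Y x (X x)) (Z x) + g.val x (Y x) (leviCivita g Z x (X x)) := by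
  have h1 : g.val x (leviCivita g Y x (X x)) (Z x) = _ := leviCivitaFun_spec g hY hX hZ
  have h2 : g.val x (leviCivita g Z x (X x)) (Y x) = _ := leviCivitaFun_spec g hZ hX hY
  have h3 : g.fn Z Y = g.fn Y Z := funext fun y ↦ g.symm y _ _
  have h4 : mlieBracket 𝓘(ℝ, E) Z Y x = - mlieBracket 𝓘(ℝ, E) Y Z x := mlieBracket_swap_apply
  rw [g.symm x (Y x), h1, h2]
  simp only [koszul, h3, h4]
  simp
  ring

end LeviCivita

section Tensors

variable {E : Type*} [NormedAddCommGroup E] [NormedSpace ℝ E]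
  {M : Type*} [TopologicalSpace M] [ChartedSpace E M]

/-- The vector field `φX`. -/
def EndField.app (φ : EndField E M) (X : VField E M) : VField E M := fun x ↦ φ x (X x)

/-- The Nijenhuis tensor
`N(X, Y) = φ²[X, Y] + [φX, φY] - φ[φX, Y] - φ[X, φY]` of a `(1,1)`-tensor field `φ`. -/
def nijenhuis (φ : EndField E M) (X Y : VField E M) : VField E M :=
  φ.app (φ.app (VectorField.mlieBracket 𝓘(ℝ, E) X Y))
    + VectorField.mlieBracket 𝓘(ℝ, E) (φ.app X) (φ.app Y)
    - φ.app (VectorField.mlieBracket 𝓘(ℝ, E) (φ.app X) Y)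
    - φ.app (VectorField.mlieBracket 𝓘(ℝ, E) X (φ.app Y))

variable [FiniteDimensional ℝ E] [CompleteSpace E] [IsManifold 𝓘(ℝ, E) ∞ M]

/-- `∇_X Y` for the Levi-Civita connection of `g`. -/
def nabla (g : PseudoMetric E M) (X Y : VField E M) : VField E M :=
  fun x ↦ leviCivita g Y x (X x)

/-- `(∇_X φ)Y = ∇_X (φY) - φ(∇_X Y)`. -/
def nablaEnd (g : PseudoMetric E M) (φ : EndField E M) (X Y : VField E M) : VField E M :=
  nabla g X (φ.app Y) - φ.app (nabla g X Y)

/-- `(∇_X η)(Y) = X(η(Y)) - η(∇_X Y)`. -/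
def nablaForm (g : PseudoMetric E M) (η : OneForm E M) (X Y : VField E M) : M → ℝ :=
  fun x ↦ mvfderiv 𝓘(ℝ, E) (fun y ↦ η y (Y y)) x (X x) - η x (nabla g X Y x)

/-- The curvature operator `R(X, Y)Z = ∇_X ∇_Y Z - ∇_Y ∇_X Z - ∇_{[X, Y]} Z`. -/
def curvature (g : PseudoMetric E M) (X Y Z : VField E M) : VField E M :=
  nabla g X (nabla g Y Z) - nabla g Y (nabla g X Z)
    - nabla g (VectorField.mlieBracket 𝓘(ℝ, E) X Y) Z

/-- The commutator `[R(X, Y), φ]Z = R(X, Y)(φZ) - φ(R(X, Y)Z)`. -/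
def curvatureComm (g : PseudoMetric E M) (φ : EndField E M) (X Y Z : VField E M) : VField E M :=
  curvature g X Y (φ.app Z) - φ.app (curvature g X Y Z)

end Tensors

/-- An almost (para)contact metric structure `(φ, ξ, η, g)` on `M` with signs `ε₀, ε₁ = ±1`
(almost contact metric if `ε₁ = -1`, almost paracontact metric if `ε₁ = 1`). -/
structure AlmostParaContactMetric (E : Type*) [NormedAddCommGroup E] [NormedSpace ℝ E]
    (M : Type*) [TopologicalSpace M] [ChartedSpace E M] [IsManifold 𝓘(ℝ, E) ∞ M]
    (ε₀ ε₁ : ℝ) where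
  φ : EndField E M
  ξ : VField E M
  η : OneForm E M
  g : PseudoMetric E M
  smooth_φ : SmoothEndField φ
  smooth_ξ : SmoothVField ξ
  smooth_η : SmoothOneForm η
  φ_sq : ∀ (x : M) (v : TangentSpace 𝓘(ℝ, E) x), φ x (φ x v) = ε₁ • (v - η x v • ξ x)
  η_ξ : ∀ x : M, η x (ξ x) = 1
  compat : ∀ (x : M) (v w : TangentSpace 𝓘(ℝ, E) x),
    g.val x (φ x v) (φ x w) = -ε₁ * (g.val x v w - ε₀ * (η x v * η x w))

/-- The condition
`(∇_{φX} φ)Y - δ φ(∇_X φ)Y - δ ε₁ (∇_X η)(Y) ξ = (δ - 1)(ε₁ g(φX, Y) ξ - ε₀ ε₁ η(Y) φX)`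
for all `X, Y ∈ 𝔛(M)`. -/
def AlmostParaContactMetric.DeltaCondition
    {E : Type*} [NormedAddCommGroup E] [NormedSpace ℝ E] [FiniteDimensional ℝ E] [CompleteSpace E]
    {M : Type*} [TopologicalSpace M] [ChartedSpace E M] [IsManifold 𝓘(ℝ, E) ∞ M]
    {ε₀ ε₁ : ℝ} (S : AlmostParaContactMetric E M ε₀ ε₁) (δ : ℝ) : Prop :=
  ∀ X Y : VField E M, SmoothVField X → SmoothVField Y → ∀ x : M,
    nablaEnd S.g S.φ (S.φ.app X) Y x - δ • S.φ x (nablaEnd S.g S.φ X Y x)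
        - (δ * ε₁ * nablaForm S.g S.η X Y x) • S.ξ x
      = (δ - 1) • ((ε₁ * S.g.val x (S.φ x (X x)) (Y x)) • S.ξ x
          - (ε₀ * ε₁ * S.η x (Y x)) • S.φ x (X x))

end ParaContact

end

/-! ### Algebraic model: a metric connection and contact tensors over a ring of functions. -/

namespace ParaContact

/-! The identity is a curvature identity on the metric cone, read at radius 1. On pairs (vector
field, function) take the cone connection `coneConn`, the metric `coneG` and the endomorphism J =
`coneJ`, with J² = ε₁ and J skew for the metric. Put C = ∇J (`coneC`). The vector part of C_X(Y, 0)
is (∇_Xφ)Y + ε₁g(X,Y)ξ - ε₀ε₁η(Y)X, the shape of the braces in the theorem.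

The hypothesis is the vector part of C_{φX} = δ J C_X on pairs (Y, 0). Both sides are skew and
anticommute with J, which forces the full equality (`eq_zero_of_skew`, `DeltaCondition.coneC_φ`).

The commutator of the cone curvature with J is the antisymmetrized derivative of C (`coneK_eq`).
Substituting C_{φX} = δ J C_X in the four commutators cancels everything except bracket terms, which
assemble into C_{φN(Z,X)} (`DeltaCondition.coneK_identity`). Since the cone curvature is R plus a
constant-curvature term (`coneCurv_eq`), the vector part on (Y, 0) is the claim, and that extra term
produces the (δ - 1) block.

All of this is algebra over a ring of functions. The analytic input is that smooth fields form such
a model, in particular that ∇ preserves smoothness (`contMDiffAt_nabla`). -/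

/-- A torsion-free metric connection together with an almost (para)contact metric structure on a
Lie–Rinehart type pair `(A, V)`, where `A` plays the role of the ring of smooth functions and `V`
that of the module of smooth vector fields. The bracket is `∇_X Y - ∇_Y X`. -/
structure ContactAlgebra (A V : Type*) [CommRing A] [AddCommGroup V] [Module A V] where
  D : V → A → A
  D_add_left : ∀ X Y f, D (X + Y) f = D X f + D Y f
  D_smul_left : ∀ (a : A) X f, D (a • X) f = a * D X f
  D_add : ∀ X f h, D X (f + h) = D X f + D X h
  D_mul : ∀ X f h, D X (f * h) = f * D X h + D X f * h
  nab : V → V → V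
  nab_add_left : ∀ X Y Z, nab (X + Y) Z = nab X Z + nab Y Z
  nab_smul_left : ∀ (a : A) X Z, nab (a • X) Z = a • nab X Z
  nab_add : ∀ X Y Z, nab X (Y + Z) = nab X Y + nab X Z
  nab_leibniz : ∀ X (f : A) Y, nab X (f • Y) = f • nab X Y + D X f • Y
  jacobi : ∀ X Y Z, let br := fun X Y ↦ nab X Y - nab Y X
    br X (br Y Z) = br (br X Y) Z + br Y (br X Z)
  g : V →ₗ[A] V →ₗ[A] A
  g_symm : ∀ X Y, g X Y = g Y X
  metric : ∀ X Y Z, D X (g Y Z) = g (nab X Y) Z + g Y (nab X Z)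
  φ : V →ₗ[A] V
  ξ : V
  η : V →ₗ[A] A
  ε₀ : A
  ε₁ : A
  ε₀_eq : ε₀ = 1 ∨ ε₀ = -1
  ε₁_eq : ε₁ = 1 ∨ ε₁ = -1
  two_cancel : ∀ a : A, 2 * a = 0 → a = 0
  φ_sq : ∀ X, φ (φ X) = ε₁ • (X - η X • ξ)
  η_ξ : η ξ = 1
  φ_ξ : φ ξ = 0
  compat : ∀ X Y, g (φ X) (φ Y) = -ε₁ * (g X Y - ε₀ * (η X * η Y))

namespace ContactAlgebra

variable {A V : Type*} [CommRing A] [AddCommGroup V] [Module A V] (S : ContactAlgebra A V)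

/-- The Lie bracket. -/
def br (X Y : V) : V := S.nab X Y - S.nab Y X

/-- The curvature operator. -/
def curv (X Y Z : V) : V :=
  S.nab X (S.nab Y Z) - S.nab Y (S.nab X Z) - S.nab (S.br X Y) Z

/-- The covariant derivative of `φ`. -/
def nabEnd (X Y : V) : V := S.nab X (S.φ Y) - S.φ (S.nab X Y)

/-- The Nijenhuis tensor of `φ`. -/
def nij (X Y : V) : V :=
  S.φ (S.φ (S.br X Y)) + S.br (S.φ X) (S.φ Y) - S.φ (S.br (S.φ X) Y) - S.φ (S.br X (S.φ Y))

lemma D_zero (X : V) : S.D X 0 = 0 := by simpa using S.D_add X 0 0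

lemma D_neg (X : V) (f : A) : S.D X (-f) = -S.D X f := by
  have := S.D_add X f (-f)
  rw [add_neg_cancel, D_zero] at this
  linear_combination -this

lemma D_sub (X : V) (f h : A) : S.D X (f - h) = S.D X f - S.D X h := by
  rw [sub_eq_add_neg, D_add, D_neg, sub_eq_add_neg]

lemma D_one (X : V) : S.D X 1 = 0 := by
  have := S.D_mul X 1 1
  simp only [mul_one, one_mul] at this
  linear_combination -this

lemma D_ε₀ (X : V) : S.D X S.ε₀ = 0 := by
  rcases S.ε₀_eq with h | h <;> simp [h, D_neg, D_one]

lemma D_ε₁ (X : V) : S.D X S.ε₁ = 0 := by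
  rcases S.ε₁_eq with h | h <;> simp [h, D_neg, D_one]

lemma ε₀_sq : S.ε₀ * S.ε₀ = 1 := by rcases S.ε₀_eq with h | h <;> simp [h]

lemma ε₁_sq : S.ε₁ * S.ε₁ = 1 := by rcases S.ε₁_eq with h | h <;> simp [h]

lemma nab_zero (X : V) : S.nab X 0 = 0 := by simpa using S.nab_add X 0 0

lemma nab_neg (X Y : V) : S.nab X (-Y) = -S.nab X Y := by
  have := S.nab_add X Y (-Y)
  rw [add_neg_cancel, nab_zero] at this
  exact (neg_eq_of_add_eq_zero_right this.symm).symm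

lemma nab_sub (X Y Z : V) : S.nab X (Y - Z) = S.nab X Y - S.nab X Z := by
  rw [sub_eq_add_neg, nab_add, nab_neg, sub_eq_add_neg]

/-- Computing φ³X in the two possible ways gives η(φX)ξ = 0; apply η. -/
lemma η_φ (X : V) : S.η (S.φ X) = 0 := by
  have h := S.φ_sq (S.φ X)
  rw [S.φ_sq X] at h
  simp only [map_smul, map_sub, S.φ_ξ, smul_zero, sub_zero, smul_sub] at h
  have := congrArg (fun v ↦ S.ε₁ * S.η v) (sub_eq_self.1 h.symm)
  simp only [map_smul, smul_eq_mul, S.η_ξ, map_zero, mul_zero, mul_one] at this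
  linear_combination this - S.η (S.φ X) * S.ε₁_sq

lemma g_ξ (X : V) : S.g X S.ξ = S.ε₀ * S.η X := by
  have h := S.compat X S.ξ
  simp only [S.φ_ξ, map_zero, S.η_ξ, mul_one] at h
  linear_combination S.ε₁ * h - (S.g X S.ξ - S.ε₀ * S.η X) * S.ε₁_sq

lemma g_φ_right (X Y : V) : S.g X (S.φ Y) = -S.g (S.φ X) Y := by
  have h := S.compat X (S.φ Y)
  simp only [S.φ_sq Y, map_smul, map_sub, smul_eq_mul, S.g_ξ, S.η_φ, mul_zero, sub_zero] at h
  linear_combination S.ε₁ * h - (S.g X (S.φ Y) + S.g (S.φ X) Y) * S.ε₁_sq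

lemma br_smul (X Y : V) (f : A) : S.br X (f • Y) = f • S.br X Y + S.D X f • Y := by
  simp only [br, S.nab_leibniz, S.nab_smul_left]; module

lemma br_add (X Y Z : V) : S.br X (Y + Z) = S.br X Y + S.br X Z := by
  simp only [br, S.nab_add, S.nab_add_left]; abel

/-- The model does not postulate that D respects brackets. The Jacobi identity for X, Y, fξ minus f
times the one for X, Y, ξ leaves only multiples of ξ, and η(ξ) = 1 extracts the coefficient. -/
lemma D_br (X Y : V) (f : A) : S.D (S.br X Y) f = S.D X (S.D Y f) - S.D Y (S.D X f) := by
  have h1 := S.jacobi X Y (f • S.ξ)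
  have h2 := S.jacobi X Y S.ξ
  change S.br X (S.br Y _) = S.br (S.br X Y) _ + S.br Y (S.br X _) at h1 h2
  simp only [br_smul, br_add, h2] at h1
  have h3 := congrArg S.η h1
  simp only [map_add, map_smul, smul_eq_mul, S.η_ξ] at h3
  linear_combination -h3

lemma curv_add (X Y Z W : V) : S.curv X Y (Z + W) = S.curv X Y Z + S.curv X Y W := by
  simp only [curv, S.nab_add]; abel

lemma curv_smul (X Y Z : V) (f : A) : S.curv X Y (f • Z) = f • S.curv X Y Z := by
  simp only [curv, S.nab_leibniz, S.nab_add, D_br]; module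

/-! ### The cone: connection, metric, (para)complex structure, curvature. -/

/-- The connection of the cone, acting on pairs of a vector field and a function. -/
def coneConn (X : V) (w : V × A) : V × A :=
  (S.nab X w.1 - (S.ε₀ * S.ε₁ * w.2) • X, S.D X w.2 - S.g X w.1)

/-- The (para)complex structure of the cone. -/
def coneJ (w : V × A) : V × A := (S.φ w.1 + (S.ε₁ * w.2) • S.ξ, S.η w.1)

/-- The derivative of the (para)complex structure of the cone. -/
def coneC (X : V) (w : V × A) : V × A := S.coneConn X (S.coneJ w) - S.coneJ (S.coneConn X w)

/-- The metric of the cone. -/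
def coneG (w w' : V × A) : A := S.g w.1 w'.1 - S.ε₀ * S.ε₁ * (w.2 * w'.2)

/-- The curvature of the cone. -/
def coneCurv (X Y : V) (w : V × A) : V × A :=
  S.coneConn X (S.coneConn Y w) - S.coneConn Y (S.coneConn X w) - S.coneConn (S.br X Y) w

/-- The commutator of the curvature and the (para)complex structure of the cone. -/
def coneK (X Y : V) (w : V × A) : V × A := S.coneCurv X Y (S.coneJ w) - S.coneJ (S.coneCurv X Y w)

lemma coneConn_add (X : V) (w w' : V × A) :
    S.coneConn X (w + w') = S.coneConn X w + S.coneConn X w' := by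
  ext
  · simp [coneConn, S.nab_add]; module
  · simp [coneConn, S.D_add]; ring

lemma coneConn_neg (X : V) (w : V × A) : S.coneConn X (-w) = -S.coneConn X w := by
  ext
  · simp [coneConn, S.nab_neg]; module
  · simp [coneConn, S.D_neg]; ring

lemma coneConn_sub (X : V) (w w' : V × A) :
    S.coneConn X (w - w') = S.coneConn X w - S.coneConn X w' := by
  rw [sub_eq_add_neg, coneConn_add, coneConn_neg, sub_eq_add_neg]

lemma coneConn_add_left (X Y : V) (w : V × A) :
    S.coneConn (X + Y) w = S.coneConn X w + S.coneConn Y w := by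
  ext
  · simp [coneConn, S.nab_add_left]; module
  · simp [coneConn, S.D_add_left]; ring

lemma coneConn_smul_left (a : A) (X : V) (w : V × A) :
    S.coneConn (a • X) w = a • S.coneConn X w := by
  ext
  · simp [coneConn, S.nab_smul_left]; module
  · simp [coneConn, S.D_smul_left]; ring

lemma coneConn_smul (a : A) (X : V) (w : V × A) (ha : S.D X a = 0) :
    S.coneConn X (a • w) = a • S.coneConn X w := by
  ext
  · simp [coneConn, S.nab_leibniz, ha]; module
  · simp [coneConn, S.D_mul, ha]; ring

lemma coneJ_add (w w' : V × A) : S.coneJ (w + w') = S.coneJ w + S.coneJ w' := by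
  ext
  · simp [coneJ]; module
  · simp [coneJ]

lemma coneJ_smul (a : A) (w : V × A) : S.coneJ (a • w) = a • S.coneJ w := by
  ext
  · simp [coneJ]; module
  · simp [coneJ]

lemma coneJ_neg (w : V × A) : S.coneJ (-w) = -S.coneJ w := by
  simpa using S.coneJ_smul (-1) w

lemma coneJ_sub (w w' : V × A) : S.coneJ (w - w') = S.coneJ w - S.coneJ w' := by
  rw [sub_eq_add_neg, coneJ_add, coneJ_neg, sub_eq_add_neg]

lemma coneJ_sq (w : V × A) : S.coneJ (S.coneJ w) = S.ε₁ • w := by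
  ext
  · simp [coneJ, S.φ_sq, S.φ_ξ]; module
  · simp [coneJ, S.η_φ, S.η_ξ]

lemma coneC_add_left (X Y : V) (w : V × A) : S.coneC (X + Y) w = S.coneC X w + S.coneC Y w := by
  simp only [coneC, coneConn_add_left, coneJ_add]; abel

lemma coneC_smul_left (a : A) (X : V) (w : V × A) : S.coneC (a • X) w = a • S.coneC X w := by
  simp only [coneC, coneConn_smul_left, coneJ_smul, smul_sub]

lemma coneC_neg_left (X : V) (w : V × A) : S.coneC (-X) w = -S.coneC X w := by
  simpa using S.coneC_smul_left (-1) X w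

lemma coneC_sub_left (X Y : V) (w : V × A) : S.coneC (X - Y) w = S.coneC X w - S.coneC Y w := by
  rw [sub_eq_add_neg, coneC_add_left, coneC_neg_left, sub_eq_add_neg]

lemma coneC_add (X : V) (w w' : V × A) : S.coneC X (w + w') = S.coneC X w + S.coneC X w' := by
  simp only [coneC, coneConn_add, coneJ_add]; abel

/-- Tensoriality: J is linear over functions, so the two Leibniz terms cancel. -/
lemma coneC_smul (a : A) (X : V) (w : V × A) : S.coneC X (a • w) = a • S.coneC X w := by
  have (w : V × A) : S.coneConn X (a • w) = a • S.coneConn X w + S.D X a • w := by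
    ext
    · simp [coneConn, S.nab_leibniz]; module
    · simp [coneConn, S.D_mul]; ring
  simp only [coneC, coneJ_smul, this, coneJ_add]; module

/-- Differentiate J² = ε₁, whose right-hand side is constant. -/
lemma coneC_coneJ (X : V) (w : V × A) : S.coneC X (S.coneJ w) = -S.coneJ (S.coneC X w) := by
  simp only [coneC, coneJ_sub, coneJ_sq, coneConn_smul _ _ _ _ (S.D_ε₁ X)]; abel

lemma coneConn_metric (X : V) (w w' : V × A) :
    S.D X (S.coneG w w') = S.coneG (S.coneConn X w) w' + S.coneG w (S.coneConn X w') := by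
  simp only [coneG, coneConn, D_sub, S.D_mul, D_ε₀, D_ε₁, S.metric, map_sub, map_smul,
    LinearMap.sub_apply, LinearMap.smul_apply, smul_eq_mul, S.g_symm _ X]
  ring

lemma coneG_coneJ (w w' : V × A) : S.coneG (S.coneJ w) w' = -S.coneG w (S.coneJ w') := by
  simp only [coneG, coneJ, map_add, map_smul, LinearMap.add_apply, LinearMap.smul_apply,
    smul_eq_mul, g_φ_right, S.g_symm S.ξ, g_ξ]
  ring

lemma coneG_sub_left (u v w : V × A) : S.coneG (u - v) w = S.coneG u w - S.coneG v w := by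
  simp [coneG]; ring

lemma coneG_sub_right (u v w : V × A) : S.coneG u (v - w) = S.coneG u v - S.coneG u w := by
  simp [coneG]; ring

lemma coneG_neg_right (u v : V × A) : S.coneG u (-v) = -S.coneG u v := by
  simp [coneG]; ring

/-- Differentiate the skewness of J along the metric connection of the cone. -/
lemma coneC_skew (X : V) (w w' : V × A) : S.coneG (S.coneC X w) w' = -S.coneG w (S.coneC X w') := by
  have h1 := S.coneConn_metric X (S.coneJ w) w'
  have h2 := S.coneConn_metric X w (S.coneJ w')
  rw [coneG_coneJ, D_neg, coneG_coneJ] at h1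
  simp only [coneC, coneG_sub_left, coneG_sub_right, coneG_coneJ]
  linear_combination -h1 - h2

lemma coneC_coneJ_skew (X : V) (w w' : V × A) :
    S.coneG (S.coneJ (S.coneC X w)) w' = -S.coneG w (S.coneJ (S.coneC X w')) := by
  rw [coneG_coneJ, coneC_skew, coneC_coneJ, coneG_neg_right, neg_neg]

lemma coneG_smul_left (a : A) (u v : V × A) : S.coneG (a • u) v = a * S.coneG u v := by
  simp [coneG]; ring

lemma coneG_smul_right (a : A) (u v : V × A) : S.coneG u (a • v) = a * S.coneG u v := by
  simp [coneG]; ring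

lemma coneK_eq (X Y : V) (w : V × A) : S.coneK X Y w =
    S.coneConn X (S.coneC Y w) + S.coneC X (S.coneConn Y w) - S.coneConn Y (S.coneC X w)
      - S.coneC Y (S.coneConn X w) - S.coneC (S.br X Y) w := by
  simp only [coneK, coneC, coneCurv, coneConn_sub, coneJ_sub]; abel

/-- The vector field part of the derivative of the (para)complex structure of the cone. -/
lemma coneC_fst (X Y : V) : (S.coneC X (Y, 0)).1 =
    S.nabEnd X Y + (S.ε₁ * S.g X Y) • S.ξ - (S.ε₀ * S.ε₁ * S.η Y) • X := by
  simp [coneC, coneConn, coneJ, nabEnd, D_zero]; module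

lemma coneC_snd (X Y : V) : (S.coneC X (Y, 0)).2 =
    S.D X (S.η Y) - S.η (S.nab X Y) + S.g (S.φ X) Y := by
  simp [coneC, coneConn, coneJ, g_φ_right]; ring

/-- Gauss-type formula. The cone curvature annihilates the radial direction and has no radial
component: the latter follows from metricity, vanishing torsion and `D_br`. -/
lemma coneCurv_eq (X Y Z : V) (f : A) : S.coneCurv X Y (Z, f) =
    (S.curv X Y Z + (S.ε₀ * S.ε₁) • (S.g Y Z • X - S.g X Z • Y), 0) := by
  ext
  · simp only [coneCurv, coneConn, Prod.fst_sub, curv, S.nab_sub, S.nab_leibniz, S.D_mul, D_ε₀, D_ε₁]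
    simp only [br]
    module
  · simp only [coneCurv, coneConn, Prod.snd_sub, D_br, D_sub, S.metric, map_sub, map_smul,
      smul_eq_mul]
    simp only [br, map_sub, LinearMap.sub_apply]
    linear_combination S.ε₀ * S.ε₁ * f * S.g_symm X Y

/-- The commutator `[R(X, Y), φ]`. -/
def curvComm (X Y Z : V) : V := S.curv X Y (S.φ Z) - S.φ (S.curv X Y Z)

lemma coneK_fst (X Y Z : V) (f : A) : (S.coneK X Y (Z, f)).1 =
    S.curvComm X Y Z + (S.ε₁ * f) • S.curv X Y S.ξ
      + (S.ε₀ * S.ε₁) • (S.g Y (S.φ Z) • X - S.g X (S.φ Z) • Y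
        + (S.ε₁ * f) • (S.g Y S.ξ • X - S.g X S.ξ • Y)
        - (S.g Y Z • S.φ X - S.g X Z • S.φ Y)) := by
  simp only [coneK, coneJ, coneCurv_eq, curv_add, curv_smul, curvComm, Prod.fst_sub, map_add,
    map_smul, map_sub, mul_zero, zero_smul, smul_eq_mul]
  module

/-- A map which is skew for the metric of the cone, anticommutes with its (para)complex structure
and maps vector fields to functions vanishes. -/
lemma eq_zero_of_skew (F : V × A → V × A) (hadd : ∀ u v, F (u + v) = F u + F v)
    (hskew : ∀ u v, S.coneG (F u) v = -S.coneG u (F v)) (hJ : ∀ u, F (S.coneJ u) = -S.coneJ (F u))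
    (h : ∀ Y, (F (Y, 0)).1 = 0) (u : V × A) : F u = 0 := by
  have hvec (Y : V) : F (Y, 0) = (0, (F (Y, 0)).2) := Prod.ext (h Y) rfl
  -- The radial direction is Jξ, so F there is determined by F on multiples of ξ.
  have hfun (f : A) : F (0, f) = (-(S.ε₁ * (F (f • S.ξ, 0)).2) • S.ξ, 0) := by
    have h1 := hJ (f • S.ξ, 0)
    have h2 : S.coneJ (f • S.ξ, 0) = (0, f) := by simp [coneJ, S.φ_ξ, S.η_ξ]
    rw [h2, hvec] at h1
    rw [h1]
    ext <;> simp [coneJ]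
  have hη (Y : V) : (F (Y, 0)).2 = (F (S.η Y • S.ξ, 0)).2 := by
    have h1 := hJ (Y, 0)
    have h2 : S.coneJ (Y, 0) = (S.φ Y, 0) + (0, S.η Y) := by simp [coneJ]
    rw [h2, hadd, hvec, hfun, hvec Y] at h1
    have h3 := congrArg (fun w ↦ S.ε₁ * S.η w.1) h1
    simp [coneJ, S.η_ξ] at h3
    linear_combination -h3 + ((F (S.η Y • S.ξ, 0)).2 - (F (Y, 0)).2) * S.ε₁_sq
  -- Skewness is tested against the unit radial section (0, 1). At Y = ξ it says that the remaining
  -- scalar equals its own negative.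
  have hsk (Y : V) : (F (Y, 0)).2 = -S.η Y * (F (S.ξ, 0)).2 := by
    have h1 := hskew (Y, 0) (0, 1)
    rw [hvec, hfun] at h1
    simp [coneG, g_ξ] at h1
    linear_combination -S.ε₀ * S.ε₁ * h1 -
      ((F (Y, 0)).2 + S.η Y * (F (S.ξ, 0)).2) * (S.ε₁ * S.ε₁ * S.ε₀_sq + S.ε₁_sq)
  have hξ : (F (S.ξ, 0)).2 = 0 := S.two_cancel _ <| by
    have := hsk S.ξ
    rw [S.η_ξ] at this
    linear_combination this
  have hz (Y : V) : F (Y, 0) = 0 := by rw [hvec, hsk, hξ]; simp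
  have : u = (u.1, 0) + (0, u.2) := by simp
  rw [this, hadd, hz, hfun, hz]
  simp

/-! ### Consequences of the structure condition. -/

/-- The condition on the covariant derivative of `φ`. -/
def DeltaCondition (δ : A) : Prop := ∀ X Y,
  S.nabEnd (S.φ X) Y - δ • S.φ (S.nabEnd X Y)
      - (δ * S.ε₁ * (S.D X (S.η Y) - S.η (S.nab X Y))) • S.ξ
    = (δ - 1) • ((S.ε₁ * S.g (S.φ X) Y) • S.ξ - (S.ε₀ * S.ε₁ * S.η Y) • S.φ X)

variable {S}

/-- The difference of the two sides satisfies `eq_zero_of_skew`: C_X and J C_X are both skew and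
both anticommute with J, and the remaining requirement is exactly the hypothesis. -/
lemma DeltaCondition.coneC_φ {δ : A} (hS : S.DeltaCondition δ) (X : V) (w : V × A) :
    S.coneC (S.φ X) w = δ • S.coneJ (S.coneC X w) := by
  refine sub_eq_zero.1 (S.eq_zero_of_skew
    (fun w ↦ S.coneC (S.φ X) w - δ • S.coneJ (S.coneC X w)) (fun u v ↦ ?_) (fun u v ↦ ?_)
    (fun u ↦ ?_) (fun Y ↦ ?_) w)
  · simp only [coneC_add, coneJ_add]; module
  · have h1 := S.coneC_skew (S.φ X) u v
    have h2 := S.coneC_coneJ_skew X u v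
    simp only [coneG_sub_left, coneG_sub_right, coneG_smul_left, coneG_smul_right, h1, h2]
    ring
  · simp only [coneC_coneJ, coneJ_sub, coneJ_smul, coneJ_neg]; module
  · have h := hS X Y
    have h1 : (S.coneJ (S.coneC X (Y, 0))).1 =
        S.φ (S.coneC X (Y, 0)).1 + (S.ε₁ * (S.coneC X (Y, 0)).2) • S.ξ := rfl
    simp only [Prod.fst_sub, Prod.smul_fst, h1, coneC_fst, coneC_snd, map_sub, map_add, map_smul,
      S.φ_ξ]
    rw [sub_sub, sub_eq_iff_eq_add] at h
    rw [h]
    module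

/-- Every C_{φ·} becomes δ J C, and J is moved out past C with a sign and past ∇ with an error C.
The second-order terms and the quadratic terms C_Z C_X, C_X C_Z then cancel in pairs. -/
lemma DeltaCondition.coneK_identity {δ : A} (hδ : δ = 1 ∨ δ = -1) (hS : S.DeltaCondition δ)
    (X Z : V) (w : V × A) :
    δ • S.coneK Z (S.φ X) w + δ • S.coneK (S.φ Z) X w
      + S.ε₁ • S.coneK (S.φ Z) (S.φ X) (S.coneJ w) + S.coneK Z X (S.coneJ w)
    = (δ * S.ε₁) • S.coneC (S.φ (S.nij Z X)) w := by
  have hD (X : V) : S.D X δ = 0 := by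
    rcases hδ with h | h <;> simp [h, D_neg, D_one]
  have hJ (X : V) (w : V × A) : S.coneConn X (S.coneJ w) = S.coneC X w + S.coneJ (S.coneConn X w) := by
    simp [coneC]
  simp only [coneK_eq, nij, map_sub, map_add, coneC_sub_left, coneC_add_left, hS.coneC_φ,
    coneC_coneJ, coneC_add, coneC_smul, coneJ_add, coneJ_smul, coneJ_neg, coneJ_sq, coneConn_neg, hJ,
    coneConn_smul _ _ _ _ (hD _),
    coneConn_smul _ _ _ _ (S.D_ε₁ _)]
  rcases hδ with rfl | rfl <;> rcases S.ε₁_eq with h | h <;> simp only [h] <;> module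

/-- Vector part of `coneK_identity` on (Y, 0). As J(Y, 0) = (φY, η(Y)), the radial entry η(Y) is
what brings in the terms R(·,·)ξ. -/
theorem DeltaCondition.curvature_identity {δ : A} (hδ : δ = 1 ∨ δ = -1) (hS : S.DeltaCondition δ)
    (X Y Z : V) :
    δ • S.curvComm Z (S.φ X) Y + δ • S.curvComm (S.φ Z) X Y
        + S.ε₁ • S.curvComm (S.φ Z) (S.φ X) (S.φ Y) + S.curvComm Z X (S.φ Y)
        + S.η Y • (S.curv (S.φ Z) (S.φ X) S.ξ + S.ε₁ • S.curv Z X S.ξ)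
      = (δ * S.ε₁) • (S.nabEnd (S.φ (S.nij Z X)) Y + (S.ε₁ * S.g (S.φ (S.nij Z X)) Y) • S.ξ
            - (S.ε₀ * S.ε₁ * S.η Y) • S.φ (S.nij Z X))
        - (S.ε₀ * S.ε₁ * (δ - 1)) • ((2 * S.g (S.φ Z) Y) • S.φ X - (2 * S.g (S.φ X) Y) • S.φ Z
            - S.g (S.φ Z) (S.φ Y) • X + S.g (S.φ X) (S.φ Y) • Z
            + S.g Z Y • S.φ (S.φ X) - S.g X Y • S.φ (S.φ Z)) := by
  have h := congrArg Prod.fst (hS.coneK_identity hδ X Z (Y, 0))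
  have hJ : S.coneJ (Y, 0) = (S.φ Y, S.η Y) := by simp [coneJ]
  simp only [hJ, Prod.fst_add, Prod.smul_fst, coneK_fst, coneC_fst] at h
  simp only [mul_zero, zero_smul, add_zero, g_ξ, η_φ, S.φ_sq Y, map_smul, map_sub, smul_eq_mul] at h
  rw [← sub_eq_zero] at h ⊢
  rw [← h]
  rcases S.ε₁_eq with h1 | h1 <;> rcases hδ with rfl | rfl <;> 
    simp only [h1, g_φ_right, S.φ_sq, map_smul, map_sub, LinearMap.smul_apply, LinearMap.sub_apply,
      smul_eq_mul, S.g_symm S.ξ, g_ξ] <;> module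

end ContactAlgebra

end ParaContact

/-! ### Smoothness of brackets and of the Levi-Civita connection. -/

noncomputable section
namespace ParaContact

section SmoothOperations

variable {E : Type*} [NormedAddCommGroup E] [NormedSpace ℝ E]
  {M : Type*} [TopologicalSpace M] [ChartedSpace E M]

lemma contMDiffAt_det {ι : Type*} [Fintype ι] [DecidableEq ι] {A : M → Matrix ι ι ℝ} {x : M}
    (hA : ∀ i j, ContMDiffAt 𝓘(ℝ, E) 𝓘(ℝ, ℝ) ∞ (fun y ↦ A y i j) x) :
    ContMDiffAt 𝓘(ℝ, E) 𝓘(ℝ, ℝ) ∞ (fun y ↦ (A y).det) x := by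
  simp only [Matrix.det_apply']
  exact contMDiffAt_finsetSum fun σ _ ↦ contMDiffAt_const.mul <|
    contMDiffAt_finsetProd fun i _ ↦ hA _ _

variable [IsManifold 𝓘(ℝ, E) ∞ M]

/-- A row vector killed by the Gram matrix would be the coordinates of a vector orthogonal to
everything. -/
lemma PseudoMetric.det_ne_zero (g : PseudoMetric E M) {ι : Type*} [Fintype ι] [DecidableEq ι]
    {x : M} (b : Module.Basis ι ℝ (TangentSpace 𝓘(ℝ, E) x)) :
    (Matrix.of fun i j ↦ g.val x (b i) (b j)).det ≠ 0 := by
  intro h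
  obtain ⟨v, hv, h0⟩ := Matrix.exists_vecMul_eq_zero_iff.2 h
  refine hv ?_
  have h1 : ∑ i, v i • b i = 0 := by
    refine g.nondegenerate x _ fun w ↦ ?_
    have : g.val x (∑ i, v i • b i) = 0 := by
      refine ContinuousLinearMap.coe_injective (b.ext fun j ↦ ?_)
      simpa [Matrix.vecMul, dotProduct] using congrFun h0 j
    rw [this]; rfl
  exact funext fun i ↦ Fintype.linearIndependent_iff.1 b.linearIndependent v h1 i

lemma contMDiffAt_mvfderiv_apply {f : M → ℝ} {X : VField E M} {x : M}
    (hf : ContMDiffAt 𝓘(ℝ, E) 𝓘(ℝ, ℝ) ∞ f x) (hX : CMDiffAt ∞ (T% X) x) :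
    ContMDiffAt 𝓘(ℝ, E) 𝓘(ℝ, ℝ) ∞ (fun y ↦ mvfderiv 𝓘(ℝ, E) f y (X y)) x := by
  have : IsManifold 𝓘(ℝ, E) 1 M := .of_le (n := ∞) (by simp)
  have h := ContMDiffAt.clm_apply_of_inCoordinates (hf.mfderiv_const (m := ∞) (by simp)) hX hf
  rw [Bundle.contMDiffAt_totalSpace] at h
  have h' := h.2
  simp only [mfld_simps] at h'
  exact h'

lemma EndField.contMDiffAt_app {A : EndField E M} (hA : SmoothEndField A) {X : VField E M} {x : M}
    (hX : CMDiffAt ∞ (T% X) x) : CMDiffAt ∞ (T% (A.app X)) x :=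
  ContMDiffAt.clm_bundle_apply (F₁ := E) (F₂ := E) (hA x) hX

lemma OneForm.contMDiffAt_apply {α : OneForm E M} (hα : SmoothOneForm α) {X : VField E M} {x : M}
    (hX : CMDiffAt ∞ (T% X) x) : ContMDiffAt 𝓘(ℝ, E) 𝓘(ℝ, ℝ) ∞ (fun y ↦ α y (X y)) x := by
  have h : ContMDiffAt 𝓘(ℝ, E) (𝓘(ℝ, E).prod 𝓘(ℝ, ℝ)) ∞
      (fun m ↦ Bundle.TotalSpace.mk' ℝ (E := Bundle.Trivial M ℝ) m (α m (X m))) x :=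
    ContMDiffAt.clm_bundle_apply (F₁ := E) (F₂ := ℝ) (hα x) hX
  simp only [Bundle.contMDiffAt_totalSpace] at h
  exact h.2

lemma PseudoMetric.contMDiffAt_fn (g : PseudoMetric E M) {X Y : VField E M} {x : M}
    (hX : CMDiffAt ∞ (T% X) x) (hY : CMDiffAt ∞ (T% Y) x) :
    ContMDiffAt 𝓘(ℝ, E) 𝓘(ℝ, ℝ) ∞ (g.fn X Y) x := by
  have h : ContMDiffAt 𝓘(ℝ, E) (𝓘(ℝ, E).prod 𝓘(ℝ, ℝ)) ∞
      (fun m ↦ Bundle.TotalSpace.mk' ℝ (E := Bundle.Trivial M ℝ) m (g.val m (X m) (Y m))) x :=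
    ContMDiffAt.clm_bundle_apply₂ (F₁ := E) (F₂ := E) (g.smooth x) hX hY
  simp only [Bundle.contMDiffAt_totalSpace] at h
  exact h.2

variable [CompleteSpace E]

lemma contMDiffAt_mlieBracket {X Y : VField E M} {x : M}
    (hX : CMDiffAt ∞ (T% X) x) (hY : CMDiffAt ∞ (T% Y) x) :
    CMDiffAt ∞ (T% (VectorField.mlieBracket 𝓘(ℝ, E) X Y)) x := by
  have : IsManifold 𝓘(ℝ, E) (((⊤ : ℕ∞) : WithTop ℕ∞) + 1) M := inferInstanceAs (IsManifold 𝓘(ℝ, E) ∞ M)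
  have : IsManifold 𝓘(ℝ, E) (minSmoothness ℝ 2) M := .of_le (n := ∞) <| by
    rw [minSmoothness_of_isRCLikeNormedField]; exact WithTop.coe_le_coe.2 (le_top : (2 : ℕ∞) ≤ ⊤)
  exact ContMDiffAt.mlieBracket_vectorField (n := ⊤) (m := ⊤) hX hY (by simp)

lemma contMDiffAt_koszul (g : PseudoMetric E M) {X Y Z : VField E M} {x : M}
    (hX : CMDiffAt ∞ (T% X) x) (hY : CMDiffAt ∞ (T% Y) x) (hZ : CMDiffAt ∞ (T% Z) x) :
    ContMDiffAt 𝓘(ℝ, E) 𝓘(ℝ, ℝ) ∞ (koszul g Y X Z) x :=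
  contMDiffAt_const.mul <|
    ((((contMDiffAt_mvfderiv_apply (g.contMDiffAt_fn hY hZ) hX).add
      (contMDiffAt_mvfderiv_apply (g.contMDiffAt_fn hX hZ) hY)).sub
      (contMDiffAt_mvfderiv_apply (g.contMDiffAt_fn hX hY) hZ)).add
      (g.contMDiffAt_fn (contMDiffAt_mlieBracket hX hY) hZ)).sub
      (g.contMDiffAt_fn (contMDiffAt_mlieBracket hX hZ) hY) |>.sub
      (g.contMDiffAt_fn (contMDiffAt_mlieBracket hY hZ) hX)

variable [FiniteDimensional ℝ E]

/-- In a local frame the Koszul formula is a linear system for the coefficients of ∇_X Y, with the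
Gram matrix as its matrix. Cramer's rule writes the solution as a quotient of smooth determinants.
-/
lemma contMDiffAt_nabla (g : PseudoMetric E M) {X Y : VField E M} {x : M}
    (hX : ∀ᶠ y in nhds x, CMDiffAt ∞ (T% X) y) (hY : ∀ᶠ y in nhds x, CMDiffAt ∞ (T% Y) y) :
    CMDiffAt ∞ (T% (nabla g X Y)) x := by
  have : IsManifold 𝓘(ℝ, E) 1 M := .of_le (n := ∞) (by simp)
  set e := trivializationAt E (TangentSpace 𝓘(ℝ, E) : M → Type _) x
  set b := Module.finBasis ℝ E
  have hx : x ∈ e.baseSet := FiberBundle.mem_baseSet_trivializationAt' x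
  have hs (i) {y} (hy : y ∈ e.baseSet) : CMDiffAt ∞ (T% (e.localFrame b i)) y :=
    contMDiffAt_localFrame_of_mem _ _ b i hy
  let G : M → Matrix _ _ ℝ := fun y ↦
    Matrix.of fun i j ↦ g.val y (e.localFrame b i y) (e.localFrame b j y)
  let k : M → _ → ℝ := fun y j ↦ koszul g Y X (e.localFrame b j) y
  have hdet {y} (hy : y ∈ e.baseSet) : (G y).det ≠ 0 := by
    simpa [G, e.localFrame_apply_of_mem_baseSet b hy] using g.det_ne_zero (e.basisAt b hy)
  rw [contMDiffAt_iff_localFrameCoeff b hx]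
  intro i
  have hsol : LinearMap.piApply (e.localFrameCoeff 𝓘(ℝ, E) b i) (nabla g X Y) =ᶠ[nhds x]
      fun y ↦ ((G y).transpose.updateCol i (k y)).det * ((G y).det)⁻¹ := by
    filter_upwards [hX, hY, e.open_baseSet.mem_nhds hx] with y hXy hYy hy
    have hk : k y = (G y).transpose.mulVec
        fun i ↦ e.localFrameCoeff 𝓘(ℝ, E) b i y (nabla g X Y y) := by
      ext j
      have h1 := leviCivitaFun_spec g (hYy.mdifferentiableAt (by simp))
        (hXy.mdifferentiableAt (by simp)) ((hs j hy).mdifferentiableAt (by simp))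
      have h2 := e.eq_sum_localFrameCoeff_smul (I := 𝓘(ℝ, E)) (b := b) (s := nabla g X Y) hy
      refine h1.symm.trans ?_
      change g.val y (nabla g X Y y) _ = _
      conv_lhs => rw [h2]
      simp [Matrix.mulVec, dotProduct, G, mul_comm]
    -- The Cramer map sends Gᵀc to det(G) c, so dividing by det(G) recovers the coefficients.
    have h3 := congrFun (congrArg (fun v ↦ Matrix.cramer (G y).transpose v) hk) i
    rw [Matrix.cramer_apply] at h3
    rw [h3]
    simp [Matrix.cramer_eq_adjugate_mulVec, Matrix.adjugate_mul, Matrix.smul_mulVec,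
      mul_comm _ ((G y).det)⁻¹, hdet hy]
  have hG (i j) : ContMDiffAt 𝓘(ℝ, E) 𝓘(ℝ, ℝ) ∞ (fun y ↦ G y i j) x :=
    g.contMDiffAt_fn (hs i hx) (hs j hx)
  refine ContMDiffAt.congr_of_eventuallyEq ?_ hsol
  refine (contMDiffAt_det fun j l ↦ ?_).mul ((contMDiffAt_det hG).inv₀ (hdet hx))
  by_cases h : l = i
  · subst h
    simpa using contMDiffAt_koszul g hX.self_of_nhds hY.self_of_nhds (hs j hx)
  · simpa [Matrix.updateCol_ne h] using hG l j

end SmoothOperations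
end ParaContact
end

/-! ### Smooth functions and smooth fields as an instance of the model. -/

noncomputable section
namespace ParaContact

open VectorField

section SmoothModule

variable (E : Type*) [NormedAddCommGroup E] [NormedSpace ℝ E]
  (M : Type*) [TopologicalSpace M] [ChartedSpace E M]

/-- The ring of smooth functions on `M`. -/
def smoothFunctions : Subring (M → ℝ) where
  carrier := {f | ContMDiff 𝓘(ℝ, E) 𝓘(ℝ, ℝ) ∞ f}
  mul_mem' := ContMDiff.mul
  one_mem' := contMDiff_const
  add_mem' := ContMDiff.add
  zero_mem' := contMDiff_const
  neg_mem' := ContMDiff.neg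

/-- The module of smooth vector fields over the ring of smooth functions on `M`. -/
def smoothFields [IsManifold 𝓘(ℝ, E) ∞ M] : Submodule (smoothFunctions E M) (VField E M) where
  carrier := {X | SmoothVField X}
  add_mem' := ContMDiff.add_section
  zero_mem' := Bundle.contMDiff_zeroSection ℝ _
  smul_mem' f _ hX := ContMDiff.smul_section f.2 hX

/-- A constant, as a smooth function. -/
def smoothConst (c : ℝ) : smoothFunctions E M := ⟨fun _ ↦ c, contMDiff_const⟩

end SmoothModule

section Algebra

variable {E : Type*} [NormedAddCommGroup E] [NormedSpace ℝ E]
  {M : Type*} [TopologicalSpace M] [ChartedSpace E M]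

lemma smoothFunctions.mdiffAt (f : smoothFunctions E M) (x : M) : MDiffAt f.1 x :=
  (f.2 x).mdifferentiableAt (by simp)

variable [IsManifold 𝓘(ℝ, E) ∞ M]

lemma smoothFields.mdiffAt (X : smoothFields E M) (x : M) : MDiffAt (T% X.1) x :=
  (X.2 x).mdifferentiableAt (by simp)

/-- From φ²ξ = 0 one gets φ²(φξ) = 0, hence φξ = aξ with a = η(φξ); then a²ξ = φ²ξ = 0. Concluding a
= 0 uses that the scalars are reduced, so this is done pointwise over ℝ and supplied to the model as
a field. -/
lemma AlmostParaContactMetric.φ_ξ {ε₀ ε₁ : ℝ} (hε₁ : ε₁ = 1 ∨ ε₁ = -1)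
    (S : AlmostParaContactMetric E M ε₀ ε₁) (x : M) : S.φ x (S.ξ x) = 0 := by
  have hne : ε₁ ≠ 0 := by rcases hε₁ with rfl | rfl <;> norm_num
  have h1 : S.φ x (S.φ x (S.ξ x)) = 0 := by simp [S.φ_sq, S.η_ξ]
  have h2 := S.φ_sq x (S.φ x (S.ξ x))
  rw [h1, map_zero] at h2
  have h3 := sub_eq_zero.1 ((smul_eq_zero.1 h2.symm).resolve_left hne)
  set a := S.η x (S.φ x (S.ξ x))
  rw [h3, map_smul, h3, smul_smul] at h1
  have h4 := congrArg (S.η x) h1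
  rw [map_smul, S.η_ξ, map_zero, smul_eq_mul, mul_one] at h4
  rw [h3, mul_self_eq_zero.1 h4, zero_smul]

variable [CompleteSpace E] [FiniteDimensional ℝ E]

/-- The connection applied to smooth vector fields. -/
def smoothNabla (g : PseudoMetric E M) (X Y : smoothFields E M) : smoothFields E M :=
  ⟨nabla g X.1 Y.1, fun _ ↦ contMDiffAt_nabla g (.of_forall X.2) (.of_forall Y.2)⟩

lemma smoothNabla_sub (g : PseudoMetric E M) (X Y : smoothFields E M) :
    ((smoothNabla g X Y - smoothNabla g Y X : smoothFields E M) : VField E M) =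
      mlieBracket 𝓘(ℝ, E) X.1 Y.1 :=
  funext fun x ↦ leviCivita_torsionFree g (smoothFields.mdiffAt X x) (smoothFields.mdiffAt Y x)

/-- The smooth vector fields on an almost (para)contact metric manifold. -/
def AlmostParaContactMetric.toContactAlgebra {ε₀ ε₁ : ℝ} (hε₀ : ε₀ = 1 ∨ ε₀ = -1)
    (hε₁ : ε₁ = 1 ∨ ε₁ = -1) (S : AlmostParaContactMetric E M ε₀ ε₁) :
    ContactAlgebra (smoothFunctions E M) (smoothFields E M) where
  D X f := ⟨fun x ↦ mvfderiv 𝓘(ℝ, E) f.1 x (X.1 x),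
    fun x ↦ contMDiffAt_mvfderiv_apply (f.2 x) (X.2 x)⟩
  D_add_left X Y f := by ext x; simp
  D_smul_left a X f := by
    ext x
    exact map_smul (mvfderiv 𝓘(ℝ, E) f.1 x) (a.1 x) (X.1 x)
  D_add X f h := by
    ext x
    exact congrArg (fun l ↦ l (X.1 x))
      (mvfderiv_add (smoothFunctions.mdiffAt f x) (smoothFunctions.mdiffAt h x))
  D_mul X f h := by
    ext x
    refine (congrArg (fun l ↦ l (X.1 x)) (mvfderiv_mul (smoothFunctions.mdiffAt f x)
      (smoothFunctions.mdiffAt h x))).trans ?_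
    simp
    ring
  nab := smoothNabla S.g
  nab_add_left X Y Z := by
    ext x
    exact map_add (leviCivita S.g Z.1 x) (X.1 x) (Y.1 x)
  nab_smul_left a X Z := by
    ext x
    exact map_smul (leviCivita S.g Z.1 x) (a.1 x) (X.1 x)
  nab_add X Y Z := by
    ext x
    exact congrArg (fun l ↦ l (X.1 x))
      ((leviCivita S.g).isCovariantDerivativeOnUniv.add (smoothFields.mdiffAt Y x)
        (smoothFields.mdiffAt Z x))
  nab_leibniz X f Y := by
    ext x
    exact congrArg (fun l ↦ l (X.1 x))
      ((leviCivita S.g).isCovariantDerivativeOnUniv.leibniz (smoothFields.mdiffAt Y x)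
        (smoothFunctions.mdiffAt f x))
  jacobi X Y Z := by
    have hle : minSmoothness ℝ 2 ≤ ∞ := by
      rw [minSmoothness_of_isRCLikeNormedField]; exact WithTop.coe_le_coe.2 (le_top : (2 : ℕ∞) ≤ ⊤)
    have : IsManifold 𝓘(ℝ, E) (minSmoothness ℝ 3) M := .of_le (n := ∞) <| by
      rw [minSmoothness_of_isRCLikeNormedField]; exact WithTop.coe_le_coe.2 (le_top : (3 : ℕ∞) ≤ ⊤)
    refine Subtype.ext ?_
    simp only [Submodule.coe_add, smoothNabla_sub]
    exact leibniz_identity_mlieBracket (X.2.of_le hle) (Y.2.of_le hle) (Z.2.of_le hle)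
  g := LinearMap.mk₂ _ (fun X Y ↦ ⟨S.g.fn X.1 Y.1, fun x ↦ S.g.contMDiffAt_fn (X.2 x) (Y.2 x)⟩)
    (fun X X' Y ↦ by ext x; simp [PseudoMetric.fn])
    (fun a X Y ↦ Subtype.ext (fn_smul_left S.g a.1 X.1 Y.1))
    (fun X Y Y' ↦ by ext x; simp [PseudoMetric.fn])
    (fun a X Y ↦ Subtype.ext (fn_smul_right S.g a.1 X.1 Y.1))
  g_symm X Y := by ext x; exact S.g.symm x _ _
  metric X Y Z := by
    ext x
    exact leviCivita_metric S.g (smoothFields.mdiffAt X x) (smoothFields.mdiffAt Y x)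
      (smoothFields.mdiffAt Z x)
  φ :=
    { toFun X := ⟨S.φ.app X.1, fun x ↦ EndField.contMDiffAt_app S.smooth_φ (X.2 x)⟩
      map_add' X Y := by ext x; exact map_add (S.φ x) _ _
      map_smul' a X := by ext x; exact map_smul (S.φ x) _ _ }
  ξ := ⟨S.ξ, S.smooth_ξ⟩
  η :=
    { toFun X := ⟨fun x ↦ S.η x (X.1 x), fun x ↦ OneForm.contMDiffAt_apply S.smooth_η (X.2 x)⟩
      map_add' X Y := by ext x; exact map_add (S.η x) _ _
      map_smul' a X := by ext x; exact map_smul (S.η x) _ _ }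
  ε₀ := smoothConst E M ε₀
  ε₁ := smoothConst E M ε₁
  ε₀_eq := hε₀.imp (fun h ↦ by rw [h]; rfl) (fun h ↦ by rw [h]; rfl)
  ε₁_eq := hε₁.imp (fun h ↦ by rw [h]; rfl) (fun h ↦ by rw [h]; rfl)
  two_cancel a h := by
    ext x
    have : 2 * a.1 x = 0 := congrFun (congrArg Subtype.val h) x
    simpa using this
  φ_sq X := by ext x; exact S.φ_sq x _
  η_ξ := by ext x; exact S.η_ξ x
  φ_ξ := by ext x; exact S.φ_ξ hε₁ x
  compat X Y := by ext x; exact S.compat x _ _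

lemma AlmostParaContactMetric.toContactAlgebra_br {ε₀ ε₁ : ℝ} (hε₀ : ε₀ = 1 ∨ ε₀ = -1)
    (hε₁ : ε₁ = 1 ∨ ε₁ = -1) (S : AlmostParaContactMetric E M ε₀ ε₁) (X Y : smoothFields E M) :
    (S.toContactAlgebra hε₀ hε₁).br X Y =
      ⟨mlieBracket 𝓘(ℝ, E) X.1 Y.1, fun x ↦ contMDiffAt_mlieBracket (X.2 x) (Y.2 x)⟩ :=
  Subtype.ext (smoothNabla_sub S.g X Y)

end Algebra
end ParaContact
end
theorem mainTheorem1 (n : ℕ) {M : Type*} [TopologicalSpace M] [T2Space M]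
    [ChartedSpace (EuclideanSpace ℝ (Fin (2 * n + 1))) M]
    [IsManifold 𝓘(ℝ, EuclideanSpace ℝ (Fin (2 * n + 1))) ∞ M]
    (ε₀ ε₁ δ : ℝ) (hε₀ : ε₀ = 1 ∨ ε₀ = -1) (hε₁ : ε₁ = 1 ∨ ε₁ = -1) (hδ : δ = 1 ∨ δ = -1)
    (S : ParaContact.AlmostParaContactMetric (EuclideanSpace ℝ (Fin (2 * n + 1))) M ε₀ ε₁)
    (hS : S.DeltaCondition δ)
    (X Y Z : ParaContact.VField (EuclideanSpace ℝ (Fin (2 * n + 1))) M)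
    (hX : ParaContact.SmoothVField X) (hY : ParaContact.SmoothVField Y)
    (hZ : ParaContact.SmoothVField Z) (x : M) :
    δ • ParaContact.curvatureComm S.g S.φ Z (S.φ.app X) Y x
        + δ • ParaContact.curvatureComm S.g S.φ (S.φ.app Z) X Y x
        + ε₁ • ParaContact.curvatureComm S.g S.φ (S.φ.app Z) (S.φ.app X) (S.φ.app Y) x
        + ParaContact.curvatureComm S.g S.φ Z X (S.φ.app Y) x
        + S.η x (Y x) •
          (ParaContact.curvature S.g (S.φ.app Z) (S.φ.app X) S.ξ x
            + ε₁ • ParaContact.curvature S.g Z X S.ξ x)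
      = (δ * ε₁) •
          (ParaContact.nablaEnd S.g S.φ (S.φ.app (ParaContact.nijenhuis S.φ Z X)) Y x
            + (ε₁ * S.g.val x (S.φ x (ParaContact.nijenhuis S.φ Z X x)) (Y x)) • S.ξ x
            - (ε₀ * ε₁ * S.η x (Y x)) • S.φ x (ParaContact.nijenhuis S.φ Z X x))
        - (ε₀ * ε₁ * (δ - 1)) •
          ((2 * S.g.val x (S.φ x (Z x)) (Y x)) • S.φ x (X x)
            - (2 * S.g.val x (S.φ x (X x)) (Y x)) • S.φ x (Z x)
            - S.g.val x (S.φ x (Z x)) (S.φ x (Y x)) • X x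
            + S.g.val x (S.φ x (X x)) (S.φ x (Y x)) • Z x
            + S.g.val x (Z x) (Y x) • S.φ x (S.φ x (X x))
            - S.g.val x (X x) (Y x) • S.φ x (S.φ x (Z x))) := by
  have hC : (S.toContactAlgebra hε₀ hε₁).DeltaCondition (ParaContact.smoothConst _ M δ) := fun X Y ↦ by
    ext x
    exact hS X.1 Y.1 X.2 Y.2 x
  have h := hC.curvature_identity (hδ.imp (fun h ↦ by rw [h]; rfl) (fun h ↦ by rw [h]; rfl))
    ⟨X, hX⟩ ⟨Y, hY⟩ ⟨Z, hZ⟩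
  -- Brackets in the model are ∇_X Y - ∇_Y X and become Lie brackets by vanishing torsion; the rest
  -- agrees definitionally.
  simp only [ParaContact.ContactAlgebra.curvComm, ParaContact.ContactAlgebra.curv,
    ParaContact.ContactAlgebra.nij,    ParaContact.AlmostParaContactMetric.toContactAlgebra_br] at h
  exact congrFun (congrArg Subtype.val h) x
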